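/- Let $\mathbb K=\mathbb R$ or $\mathbb C$, let $X_1,\dots,X_m,Y$ be Banach spaces over $\mathbb K$, and let $U:X_1\times\cdots\times X_m\to Y$ be a bounded $m$-linear map. \emph{Notation.} Let $r_1,r_2,\dots$ be the Rademacher functions on $[0,1]$. The space $Y$ has cotype $q$ ($2\le q<\infty$) if there is $C>0$ with $\bigl(\sum_{k=1}^{n}\|y_k\|^q\bigr)^{1/q}\le C\bigl(\int_0^1\|\sum_{k=1}^{n} r_k(t)y_k\|^2dt\bigr)^{1/2}$ for all finite families $y_1,\dots,y_n$ in $Y$; the infimum of such $C$ is $C_q(Y)$. For $1\le r<\infty$ let $K_{r,2}$ be the best constant $K>0$ in Kahane's inequality $\bigl(\int_0^1\|\sum_k r_k(t)z_k\|^2dt\bigr)^{1/2}\le K\bigl(\int_0^1\|\sum_k r_k(t)z_k\|^rdt\bigr)^{1/r}$ (for all finite families in all Banach spaces over $\mathbb K$), and put $A_{q,r}(Y):=C_q(Y)K_{r,2}$. For a finite family in a Banach space $X$ put $\|(x_i)_{i=1}^N\|_{w,1}:=\sup_{\|x'\|_{X'}\le1}\sum_{i=1}^N|x'(x_i)|$.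 A bounded multilinear map $V$ on $\prod_{k\in D}X_k$ ($D$ finite) with values in $Y$ is multiple $(r,1)$-summing if there is $C>0$ such that $$\Bigl(\sum_{\mathbf i\in\{1,\dots,N\}^{D}}\bigl\|V\bigl((x^{(k)}_{i_k})_{k\in D}\bigr)\bigr\|^r\Bigr)^{1/r}\le C\prod_{k\in D}\bigl\|(x^{(k)}_i)_{i=1}^N\bigr\|_{w,1}$$ for all $N$ and all $x^{(k)}_1,\dots,x^{(k)}_N\in X_k$, $k\in D$; the infimum of such $C$ is $\pi_{(r,1)}(V)$, and $\Pi_{(r,1)}^{|D|}(X^D;Y)$ is the space of all such $V$, normed by $\pi_{(r,1)}$. For a non-empty proper subset $D\subset\{1,\dots,m\}$ put $\widehat D:=\{1,\dots,m\}\setminus D$, $X^D:=\prod_{k\in D}X_k$, and for $z\in X^{\widehat D}$ let $U^D_z:X^D\to Y$ be the restriction of $U$ to the coordinates in $D$ with the other coordinates fixed equal to $z$. The map $U$ is multiple $(r,1)$-summing in $D$ if $U^D_z\in\Pi_{(r,1)}^{|D|}(X^D;Y)$ for every $z\in X^{\widehat D}$; then $\|U^D:X^{\widehat D}\to\Pi^{|D|}_{(r,1)}(X^D;Y)\|$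 denotes the norm of the multilinear map $z\mapsto U^D_z$, i.e. the least $M\ge0$ with $\pi_{(r,1)}(U^D_z)\le M\prod_{k\in\widehat D}\|z_k\|$ for all $z$. \emph{Theorem.} Let $Y$ have cotype $q$, let $1\le r_1,\dots,r_n\le q$, and let $\{1,\dots,m\}$ be the disjoint union of non-empty proper subsets $C_1,\dots,C_n$. Suppose that $U$ is multiple $(r_k,1)$-summing in $C_k$ for each $k=1,\dots,n$. Let $\theta_1,\dots,\theta_n\in[0,1]$ with $\sum_{k=1}^n\theta_k=1$, and let $q_k\in[r_k,q]$ be given by $\frac1{q_k}=\frac{\theta_k}{r_k}+\frac{1-\theta_k}{q}$. Then, for every $N$ and all $x^{(l)}_1,\dots,x^{(l)}_N\in X_l$ with $\|(x^{(l)}_j)_{j=1}^N\|_{w,1}\le1$, $l=1,\dots,m$, $$\Bigl(\sum_{\mathbf i_{C_1}}\Bigl(\sum_{\mathbf i_{C_2}}\Bigl(\cdots\Bigl(\sum_{\mathbf i_{C_n}}\bigl\|U\bigl(x^{(1)}_{i_1},\dots,x^{(m)}_{i_m}\bigr)\bigr\|^{q_n}\Bigr)^{\frac{q_{n-1}}{q_n}}\cdots\Bigr)^{\frac{q_2}{q_3}}\Bigr)^{\frac{q_1}{q_2}}\Bigr)^{\frac1{q_1}}\le\prod_{k=1}^n\Bigl[A_{q,r_k}(Y)^{|\widehat{C_k}|}\,\bigl\|U^{C_k}:X^{\widehat{C_k}}\to\Pi^{|C_k|}_{(r_k,1)}(X^{C_k};Y)\bigr\|\Bigr]^{\theta_k},$$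 where $\sum_{\mathbf i_{C_k}}$ is the sum over the indices $i_l\in\{1,\dots,N\}$ with $l\in C_k$. -/

import Mathlib

open scoped BigOperators

noncomputable section

namespace MultSumm

/-- The `k`-th Rademacher function: `(-1) ^ ⌊2 ^ k t⌋`, which is `sign (sin (2 ^ k π t))` off the
dyadic rationals. It takes the values `1` and `-1` in `ℤ`, so it acts on every normed group. -/
def rademacher (k : ℕ) (t : ℝ) : ℤ := if Even ⌊(2 : ℝ) ^ k * t⌋ then 1 else -1

/-- `(∫₀¹ ‖∑ₖ rₖ(t) xₖ‖ ^ p dt) ^ (1 / p)`, where `r₁, r₂, …` are the Rademacher functions. -/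
def rademacherNorm {X : Type*} [NormedAddCommGroup X] (p : ℝ) {n : ℕ} (x : Fin n → X) : ℝ :=
  (∫ t in (0 : ℝ)..1, ‖∑ k : Fin n, rademacher (k + 1) t • x k‖ ^ p) ^ (1 / p)

/-- `C > 0` is a constant in the cotype `q` inequality of `X`. -/
def IsCotypeConst (X : Type*) [NormedAddCommGroup X] (q C : ℝ) : Prop :=
  0 < C ∧ ∀ (n : ℕ) (x : Fin n → X),
    (∑ k, ‖x k‖ ^ q) ^ (1 / q) ≤ C * rademacherNorm 2 x

/-- `X` has cotype `q` (where `2 ≤ q < ∞`). -/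
def HasCotype (X : Type*) [NormedAddCommGroup X] (q : ℝ) : Prop :=
  2 ≤ q ∧ ∃ C : ℝ, IsCotypeConst X q C

/-- The cotype `q` constant `C_q(X)`. -/
def cotypeConst (X : Type*) [NormedAddCommGroup X] (q : ℝ) : ℝ :=
  sInf {C : ℝ | IsCotypeConst X q C}

/-- `K > 0` is a constant in Kahane's inequality: the `L_q` norm of a Rademacher sum is at most
`K` times its `L_p` norm, in every Banach space over `𝕜`. -/
def IsKahaneConst.{v, w} (𝕜 : Type w) [RCLike 𝕜] (p q K : ℝ) : Prop :=
  0 < K ∧ ∀ (X : Type v) [NormedAddCommGroup X] [NormedSpace 𝕜 X] [CompleteSpace X]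
    (n : ℕ) (x : Fin n → X), rademacherNorm q x ≤ K * rademacherNorm p x

/-- The best constant `K_{p,q}` in Kahane's inequality. -/
def kahaneConst.{v, w} (𝕜 : Type w) [RCLike 𝕜] (p q : ℝ) : ℝ :=
  sInf {K : ℝ | IsKahaneConst.{v, w} 𝕜 p q K}

/-- `A_{q,r}(Y) = C_q(Y) K_{r,2}`. -/
def constA.{v, w} (𝕜 : Type w) [RCLike 𝕜] (Y : Type v) [NormedAddCommGroup Y] (q r : ℝ) : ℝ :=
  cotypeConst Y q * kahaneConst.{v, w} 𝕜 r 2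

/-- The weak `ℓ₁`-norm `sup_{‖φ‖ ≤ 1} ∑ᵢ |φ(xᵢ)|` of a finite family. -/
def weakL1Norm (𝕜 : Type*) [RCLike 𝕜] {X : Type*} [NormedAddCommGroup X] [NormedSpace 𝕜 X]
    {N : ℕ} (x : Fin N → X) : ℝ :=
  ⨆ φ : {φ : X →L[𝕜] 𝕜 // ‖φ‖ ≤ 1}, ∑ i, ‖φ.1 (x i)‖

section Summing

variable {𝕜 : Type*} [RCLike 𝕜] {ι : Type*} [Fintype ι] [DecidableEq ι]
  {X : ι → Type*} [∀ i, NormedAddCommGroup (X i)] [∀ i, NormedSpace 𝕜 (X i)]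
  {Y : Type*} [NormedAddCommGroup Y] [NormedSpace 𝕜 Y]

/-- `C > 0` is a constant in the multiple `(r,1)`-summing inequality for `V`. -/
def IsSummingConst (r : ℝ) (V : ContinuousMultilinearMap 𝕜 X Y) (C : ℝ) : Prop :=
  0 < C ∧ ∀ (N : ℕ) (x : ∀ k, Fin N → X k),
    (∑ i : ι → Fin N, ‖V (fun k => x k (i k))‖ ^ r) ^ (1 / r) ≤ C * ∏ k, weakL1Norm 𝕜 (x k)

/-- `V` is multiple `(r,1)`-summing. -/
def IsMultipleSumming (r : ℝ) (V : ContinuousMultilinearMap 𝕜 X Y) : Prop :=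
  ∃ C : ℝ, IsSummingConst r V C

/-- The multiple `(r,1)`-summing norm `π_{(r,1)}(V)`. -/
def summingNorm (r : ℝ) (V : ContinuousMultilinearMap 𝕜 X Y) : ℝ :=
  sInf {C : ℝ | IsSummingConst r V C}

/-- `U^D_z`: the restriction of `U` to the coordinates in `D`, the coordinates outside `D` being
fixed through `z`. -/
def restrictTo (U : ContinuousMultilinearMap 𝕜 X Y) (D : Finset ι) (z : ∀ i : {i // i ∉ D}, X i) :
    ContinuousMultilinearMap 𝕜 (fun i : {i // i ∈ D} => X i) Y where
  toMultilinearMap := U.toMultilinearMap.domDomRestrict (fun i => i ∈ D) z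
  cont := by
    change Continuous fun x : (∀ i : {i // i ∈ D}, X i) =>
      U (fun j => if h : j ∈ D then x ⟨j, h⟩ else z ⟨j, h⟩)
    refine U.cont.comp (continuous_pi fun j => ?_)
    by_cases h : j ∈ D
    · simpa [h] using continuous_apply (⟨j, h⟩ : {i // i ∈ D})
    · simpa [h] using continuous_const

/-- `U` is multiple `(r,1)`-summing in the coordinates of `D`. -/
def IsMultipleSummingIn (r : ℝ) (U : ContinuousMultilinearMap 𝕜 X Y) (D : Finset ι) : Prop :=
  ∀ z : ∀ i : {i // i ∉ D}, X i, IsMultipleSumming r (restrictTo U D z)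

/-- The norm of the multilinear map `z ↦ U^D_z` into the space of multiple `(r,1)`-summing maps,
that is, the least `M ≥ 0` with `π_{(r,1)}(U^D_z) ≤ M ∏ ‖z_i‖` for all `z`. -/
def blockNorm (r : ℝ) (U : ContinuousMultilinearMap 𝕜 X Y) (D : Finset ι) : ℝ :=
  sInf {M : ℝ | 0 ≤ M ∧ ∀ z : ∀ i : {i // i ∉ D}, X i,
    summingNorm r (restrictTo U D z) ≤ M * ∏ i, ‖z i‖}

end Summing

/-- The mixed norm
`(∑_{j₁} (∑_{j₂} ( … (∑_{jₙ} |a_j| ^ pₙ) ^ (pₙ₋₁ / pₙ) … ) ^ (p₂ / p₃)) ^ (p₁ / p₂)) ^ (1 / p₁)`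
of a finite array with `n` indices `j_k ∈ J k`; the first index is summed outermost. -/
def mixedNorm : (n : ℕ) → (J : Fin n → Type) → [∀ k, Fintype (J k)] → (Fin n → ℝ) →
    ((∀ k, J k) → ℝ) → ℝ
  | 0, _, _, _, a => |a (fun k => k.elim0)|
  | n + 1, J, _, p, a =>
    (∑ j : J 0, mixedNorm n (fun k => J k.succ) (fun k => p k.succ)
      (fun t => a (Fin.cons j t)) ^ p 0) ^ (1 / p 0)

/-- The multi-index `i ∈ {1,…,N}^m` whose parts `i_{C_k}` are prescribed, for a cover of the
coordinates by sets `C_k` (disjoint wherever this is used). -/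
def glue {m n N : ℕ} (C : Fin n → Finset (Fin m)) (hC : ∀ l, ∃ k, l ∈ C k)
    (t : ∀ k, {l // l ∈ C k} → Fin N) : Fin m → Fin N :=
  fun l => t (hC l).choose ⟨l, (hC l).choose_spec⟩

end MultSumm

end

/-! The estimate interpolates between `n` endpoint estimates. The `k`-th endpoint is the mixed norm
with exponent `r k` in slot `k` and `q` in every other slot. Since the `θ k` add up to `1`, the
reciprocals `1 / s j` are the `θ`-averages of the reciprocal endpoint exponents, and Hölder's
inequality for mixed norms (`mixedNorm_prod_rpow_le`) bounds the left side by the product of the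
endpoints to the powers `θ k`.

For one endpoint, `r k ≤ q` and Minkowski's inequality move slot `k` outermost
(`mixedNorm_update_le`). With the indices in `C k` frozen, cotype and Kahane's inequality, iterated
over the coordinates outside `C k`, replace the inner `ℓ_q` sum by an average over signs of powers
of `‖U‖` at Rademacher sums; each coordinate costs one factor `constA`. For fixed signs these sums
have norm at most the weak `ℓ₁`-norm, hence at most `1`, so summability in `C k` bounds the
remaining `ℓ_r` sum by `blockNorm`, uniformly in the signs (`IsMultipleSummingIn.sum_rpow_le`).

The constants are infima in `ℝ`, where `sInf ∅ = 0`, so each needs an admissible value. For Kahane's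
inequality it is `√2`, from the spectral argument of Latała and Oleszkiewicz; for `blockNorm` it
comes from a Baire category argument. -/

namespace MultSumm

/-! ### Minkowski's and Hölder's inequalities for finite sums. -/

section FiniteSums

/-- Minkowski's inequality for a finite sum of nonnegative families. -/
theorem rpow_sum_sum_rpow_le {I J : Type*} (s : Finset I) (t : Finset J) {p : ℝ} (hp : 1 ≤ p)
    (b : I → J → ℝ) (hb : ∀ i j, 0 ≤ b i j) :
    (∑ i ∈ s, (∑ j ∈ t, b i j) ^ p) ^ (1 / p) ≤ ∑ j ∈ t, (∑ i ∈ s, b i j ^ p) ^ (1 / p) := by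
  classical
  induction t using Finset.induction_on with
  | empty =>
    have hp0 : p ≠ 0 := by positivity
    simp [Real.zero_rpow hp0, Real.zero_rpow (inv_ne_zero hp0)]
  | insert j t hj ih =>
    simp only [Finset.sum_insert hj]
    refine (Real.Lp_add_le_of_nonneg s hp (fun i _ => hb i j)
      (fun i _ => Finset.sum_nonneg fun j _ => hb i j)).trans ?_
    gcongr

/-- Minkowski's inequality between mixed `ℓ_q(ℓ_r)` and `ℓ_r(ℓ_q)` sums, `r ≤ q`. -/
theorem rpow_sum_sum_rpow_le_of_le {I J : Type*} (s : Finset I) (t : Finset J) {q r : ℝ}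
    (hr : 0 < r) (hrq : r ≤ q) (b : I → J → ℝ) (hb : ∀ i j, 0 ≤ b i j) :
    (∑ i ∈ s, (∑ j ∈ t, b i j ^ r) ^ (q / r)) ^ (r / q) ≤
      ∑ j ∈ t, (∑ i ∈ s, b i j ^ q) ^ (r / q) := by
  -- This is the triangle inequality in `ℓ_{q/r}` for the powers `b i j ^ r`.
  have h := rpow_sum_sum_rpow_le s t ((one_le_div hr).2 hrq) (fun i j => b i j ^ r)
    (fun i j => Real.rpow_nonneg (hb i j) r)
  have e : ∀ i j, (b i j ^ r) ^ (q / r) = b i j ^ q := fun i j => by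
    rw [← Real.rpow_mul (hb i j), mul_div_cancel₀ _ hr.ne']
  simpa only [e, one_div_div] using h

/-- Hölder's inequality for finitely many factors with weights adding up to `1`. -/
theorem sum_prod_rpow_le_prod_sum_rpow {I K : Type*} (s : Finset I) (t : Finset K) (w : K → ℝ)
    (hw : ∀ k ∈ t, 0 ≤ w k) (hw1 : ∑ k ∈ t, w k = 1) (f : K → I → ℝ) (hf : ∀ k i, 0 ≤ f k i) :
    ∑ i ∈ s, ∏ k ∈ t, f k i ^ w k ≤ ∏ k ∈ t, (∑ i ∈ s, f k i) ^ w k := by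
  set F : K → ℝ := fun k => ∑ i ∈ s, f k i with hF
  have hF0 : ∀ k, 0 ≤ F k := fun k => Finset.sum_nonneg fun i _ => hf k i
  have hsplit : ∀ i ∈ s, ∏ k ∈ t, f k i ^ w k =
      (∏ k ∈ t, (f k i / F k) ^ w k) * ∏ k ∈ t, F k ^ w k := by
    intro i hi
    rw [← Finset.prod_mul_distrib]
    refine Finset.prod_congr rfl fun k _ => ?_
    rw [← Real.mul_rpow (div_nonneg (hf k i) (hF0 k)) (hF0 k)]
    congr 1
    -- If `F k = 0`, every `f k i` with `i ∈ s` vanishes, so the splitting survives division by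
    -- zero.
    rcases eq_or_ne (F k) 0 with h0 | h0
    · rw [h0, mul_zero]
      exact (Finset.sum_eq_zero_iff_of_nonneg fun i _ => hf k i).1 h0 i hi
    · rw [div_mul_cancel₀ _ h0]
  rw [Finset.sum_congr rfl hsplit, ← Finset.sum_mul]
  refine mul_le_of_le_one_left (Finset.prod_nonneg fun k _ => Real.rpow_nonneg (hF0 k) _) ?_
  calc ∑ i ∈ s, ∏ k ∈ t, (f k i / F k) ^ w k
      ≤ ∑ i ∈ s, ∑ k ∈ t, w k * (f k i / F k) :=
        Finset.sum_le_sum fun i _ => Real.geom_mean_le_arith_mean_weighted t w _ hw hw1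
          fun k _ => div_nonneg (hf k i) (hF0 k)
    _ = ∑ k ∈ t, w k * (F k / F k) := by
        rw [Finset.sum_comm]
        refine Finset.sum_congr rfl fun k _ => ?_
        rw [← Finset.mul_sum, ← Finset.sum_div]
    _ ≤ ∑ k ∈ t, w k := Finset.sum_le_sum fun k hk =>
        mul_le_of_le_one_right (hw k hk) (div_self_le_one _)
    _ = 1 := hw1

end FiniteSums

/-! ### Mixed norms: Hölder's inequality and reordering of exponents. -/

section MixedNorm

theorem mixedNorm_nonneg : ∀ (n : ℕ) (J : Fin n → Type) [∀ k, Fintype (J k)] (p : Fin n → ℝ)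
    (a : (∀ k, J k) → ℝ), 0 ≤ mixedNorm n J p a
  | 0, _, _, _, _ => abs_nonneg _
  | n + 1, _, _, _, _ => Real.rpow_nonneg (Finset.sum_nonneg fun _ _ =>
      Real.rpow_nonneg (mixedNorm_nonneg n _ _ _) _) _

/-- Hölder's inequality for mixed norms. -/
theorem mixedNorm_prod_rpow_le {K : Type*} [Fintype K] (θ : K → ℝ) (hθ : ∀ k, 0 ≤ θ k) :
    ∀ (n : ℕ) (J : Fin n → Type) [∀ k, Fintype (J k)] (s : Fin n → ℝ) (p : K → Fin n → ℝ)
      (_ : ∀ j, 0 < s j) (_ : ∀ k j, 0 < p k j) (_ : ∀ j, 1 / s j = ∑ k, θ k / p k j)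
      (a : K → (∀ k, J k) → ℝ) (_ : ∀ k t, 0 ≤ a k t),
      mixedNorm n J s (fun t => ∏ k, a k t ^ θ k) ≤ ∏ k, mixedNorm n J (p k) (a k) ^ θ k
  | 0, J, _, s, p, _, _, _, a, ha => by
    simp only [mixedNorm]
    rw [abs_of_nonneg (Finset.prod_nonneg fun k _ => Real.rpow_nonneg (ha k _) _)]
    exact le_of_eq (Finset.prod_congr rfl fun k _ => by rw [abs_of_nonneg (ha k _)])
  | n + 1, J, _, s, p, hs, hp, hsp, a, ha => by
    simp only [mixedNorm]
    set c : K → J 0 → ℝ := fun k j => mixedNorm n (fun i => J i.succ) (fun i => p k i.succ)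
      (fun t => a k (Fin.cons j t)) with hc
    have hc0 : ∀ k j, 0 ≤ c k j := fun k j => mixedNorm_nonneg _ _ _ _
    have ih : ∀ j, mixedNorm n (fun i => J i.succ) (fun i => s i.succ)
        (fun t => ∏ k, a k (Fin.cons j t) ^ θ k) ≤ ∏ k, c k j ^ θ k := fun j =>
      mixedNorm_prod_rpow_le θ hθ n (fun i => J i.succ) (fun i => s i.succ)
        (fun k i => p k i.succ) (fun i => hs _) (fun k i => hp _ _) (fun i => hsp _)
        (fun k t => a k (Fin.cons j t)) (fun k t => ha _ _)
    -- These are the Hölder weights of the outermost sum; they turn `c k j ^ p k 0` into `c k j ^ (θ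
    -- k * s 0)`.
    have hw1 : ∑ k, s 0 * (θ k / p k 0) = 1 := by
      rw [← Finset.mul_sum, ← hsp, mul_one_div_cancel (hs 0).ne']
    have key := sum_prod_rpow_le_prod_sum_rpow Finset.univ Finset.univ
      (fun k => s 0 * (θ k / p k 0))
      (fun k _ => mul_nonneg (hs 0).le (div_nonneg (hθ k) (hp k 0).le)) hw1
      (fun k j => c k j ^ p k 0) (fun k j => Real.rpow_nonneg (hc0 k j) _)
    have e : ∀ j, ∏ k, (c k j ^ p k 0) ^ (s 0 * (θ k / p k 0)) = (∏ k, c k j ^ θ k) ^ s 0 := by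
      intro j
      rw [← Real.finsetProd_rpow _ _ fun k _ => Real.rpow_nonneg (hc0 k j) _]
      refine Finset.prod_congr rfl fun k _ => ?_
      rw [← Real.rpow_mul (hc0 k j), ← Real.rpow_mul (hc0 k j)]
      congr 1
      have := (hp k 0).ne'
      field_simp
    simp only [e] at key
    calc _ ≤ (∑ j, (∏ k, c k j ^ θ k) ^ s 0) ^ (1 / s 0) := by
          refine Real.rpow_le_rpow (Finset.sum_nonneg fun j _ =>
            Real.rpow_nonneg (mixedNorm_nonneg _ _ _ _) _) ?_ (one_div_nonneg.2 (hs 0).le)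
          exact Finset.sum_le_sum fun j _ =>
            Real.rpow_le_rpow (mixedNorm_nonneg _ _ _ _) (ih j) (hs 0).le
      _ ≤ (∏ k, (∑ j, c k j ^ p k 0) ^ (s 0 * (θ k / p k 0))) ^ (1 / s 0) := by
          refine Real.rpow_le_rpow (Finset.sum_nonneg fun j _ => Real.rpow_nonneg
            (Finset.prod_nonneg fun k _ => Real.rpow_nonneg (hc0 k j) _) _) key
            (one_div_nonneg.2 (hs 0).le)
      _ = _ := by
          have h0 : ∀ k, 0 ≤ ∑ j, c k j ^ p k 0 := fun k =>
            Finset.sum_nonneg fun j _ => Real.rpow_nonneg (hc0 k j) _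
          rw [← Real.finsetProd_rpow _ _ fun k _ => Real.rpow_nonneg (h0 k) _]
          refine Finset.prod_congr rfl fun k _ => ?_
          rw [← Real.rpow_mul (h0 k), ← Real.rpow_mul (h0 k)]
          congr 1
          have := (hp k 0).ne'
          have := (hs 0).ne'
          field_simp

theorem sum_fin_pi_succ {M : Type*} [AddCommMonoid M] {n : ℕ} (J : Fin (n + 1) → Type)
    [∀ k, Fintype (J k)] (f : (∀ k, J k) → M) :
    ∑ t, f t = ∑ j : J 0, ∑ t : ∀ k : Fin n, J k.succ, f (Fin.cons j t) := by
  rw [← Fintype.sum_prod_type' (f := fun j t => f (Fin.cons j t))]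
  exact (Fintype.sum_equiv (Fin.consEquiv J) _ _ fun _ => rfl).symm

theorem mixedNorm_const {q : ℝ} (hq : 0 < q) : ∀ (n : ℕ) (J : Fin n → Type)
    [∀ k, Fintype (J k)] (a : (∀ k, J k) → ℝ),
    mixedNorm n J (fun _ => q) a = (∑ t, |a t| ^ q) ^ (1 / q)
  | 0, J, _, a => by
    simp only [mixedNorm, Fintype.sum_unique, one_div, Real.rpow_rpow_inv (abs_nonneg _) hq.ne']
    congr 2
  | n + 1, J, _, a => by
    simp only [mixedNorm, mixedNorm_const hq n]
    rw [sum_fin_pi_succ]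
    congr 1
    refine Finset.sum_congr rfl fun j _ => ?_
    rw [one_div, Real.rpow_inv_rpow (Finset.sum_nonneg fun t _ =>
      Real.rpow_nonneg (abs_nonneg _) _) hq.ne']

open Classical in
/-- The mixed norm with one exponent `r ≤ q` and all others equal to `q` is largest when the
index with exponent `r` is summed outermost. -/
theorem mixedNorm_update_le {q r : ℝ} (hr : 0 < r) (hrq : r ≤ q) : ∀ (n : ℕ) (J : Fin n → Type)
    [∀ k, Fintype (J k)] (k : Fin n) (a : (∀ k, J k) → ℝ),
    mixedNorm n J (fun i => if i = k then r else q) a ≤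
      (∑ j : J k, (∑ t, if t k = j then |a t| ^ q else 0) ^ (r / q)) ^ (1 / r)
  | 0, _, _, k, _ => k.elim0
  | n + 1, J, _, k, a => by
    have hq : 0 < q := hr.trans_le hrq
    refine Fin.cases ?_ (fun k => ?_) k
    · simp only [mixedNorm, Fin.succ_ne_zero, if_false, if_true, mixedNorm_const hq n]
      refine Real.rpow_le_rpow (Finset.sum_nonneg fun j _ => Real.rpow_nonneg
        (Real.rpow_nonneg (Finset.sum_nonneg fun t _ => Real.rpow_nonneg (abs_nonneg _) _) _) _)
        (Finset.sum_le_sum fun j _ => ?_) (one_div_nonneg.2 hr.le)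
      rw [sum_fin_pi_succ, ← Real.rpow_mul (Finset.sum_nonneg fun t _ =>
        Real.rpow_nonneg (abs_nonneg _) _), one_div_mul_eq_div]
      simp only [Fin.cons_zero]
      rw [Finset.sum_eq_single j (fun b _ hb => by simp [hb]) (by simp)]
      simp
    · simp only [mixedNorm, Fin.succ_inj, (Fin.succ_ne_zero k).symm, if_false]
      -- The induction hypothesis moves slot `k` to second place. It remains to exchange it with
      -- `j₀`, by Minkowski for `b ^ (1 / q)`.
      set b : J 0 → J k.succ → ℝ := fun j₀ j =>
        (∑ t : ∀ i : Fin n, J i.succ, if t k = j then |a (Fin.cons j₀ t)| ^ q else 0) with hb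
      have hb0 : ∀ j₀ j, 0 ≤ b j₀ j := fun j₀ j => Finset.sum_nonneg fun t _ => by
        split_ifs
        · exact Real.rpow_nonneg (abs_nonneg _) _
        · exact le_rfl
      have h1 : ∀ j₀, mixedNorm n (fun i => J i.succ) (fun i => if i = k then r else q)
          (fun t => a (Fin.cons j₀ t)) ^ q ≤ (∑ j, b j₀ j ^ (r / q)) ^ (q / r) := by
        intro j₀
        have := Real.rpow_le_rpow (mixedNorm_nonneg _ _ _ _)
          (mixedNorm_update_le hr hrq n (fun i => J i.succ) k (fun t => a (Fin.cons j₀ t))) hq.le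
        refine this.trans (le_of_eq ?_)
        rw [← Real.rpow_mul (Finset.sum_nonneg fun j _ => Real.rpow_nonneg (hb0 j₀ j) _),
          one_div_mul_eq_div]
      have h2 := rpow_sum_sum_rpow_le_of_le Finset.univ Finset.univ hr hrq
        (fun j₀ j => b j₀ j ^ (1 / q)) (fun j₀ j => Real.rpow_nonneg (hb0 j₀ j) _)
      have e1 : ∀ j₀ j, (b j₀ j ^ (1 / q)) ^ r = b j₀ j ^ (r / q) := fun j₀ j => by
        rw [← Real.rpow_mul (hb0 j₀ j), one_div_mul_eq_div]
      have e2 : ∀ j₀ j, (b j₀ j ^ (1 / q)) ^ q = b j₀ j := fun j₀ j => by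
        rw [one_div, Real.rpow_inv_rpow (hb0 j₀ j) hq.ne']
      simp only [e1, e2] at h2
      have e3 : ∀ j : J k.succ, (∑ t, if t k.succ = j then |a t| ^ q else 0) = ∑ j₀, b j₀ j := by
        intro j
        rw [sum_fin_pi_succ]
        rfl
      simp only [e3]
      have h3 : 0 ≤ ∑ j₀, (∑ j, b j₀ j ^ (r / q)) ^ (q / r) := Finset.sum_nonneg fun j₀ _ =>
        Real.rpow_nonneg (Finset.sum_nonneg fun j _ => Real.rpow_nonneg (hb0 j₀ j) _) _
      calc _ ≤ (∑ j₀, (∑ j, b j₀ j ^ (r / q)) ^ (q / r)) ^ (1 / q) :=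
            Real.rpow_le_rpow (Finset.sum_nonneg fun j _ =>
              Real.rpow_nonneg (mixedNorm_nonneg _ _ _ _) _)
              (Finset.sum_le_sum fun j _ => h1 j) (one_div_nonneg.2 hq.le)
        _ = ((∑ j₀, (∑ j, b j₀ j ^ (r / q)) ^ (q / r)) ^ (r / q)) ^ (1 / r) := by
            rw [← Real.rpow_mul h3]
            congr 1
            field_simp
        _ ≤ _ := Real.rpow_le_rpow (Real.rpow_nonneg h3 _) h2 (one_div_nonneg.2 hr.le)

end MixedNorm

/-! ### Rademacher averages as averages over signs. -/

section Rademacher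

/-- The `k`-th Rademacher function with values in the units of `ℤ`. -/
noncomputable def rademacherUnit (k : ℕ) (t : ℝ) : ℤˣ := if Even ⌊(2 : ℝ) ^ k * t⌋ then 1 else -1

theorem coe_rademacherUnit (k : ℕ) (t : ℝ) : (rademacherUnit k t : ℤ) = rademacher k t := by
  unfold rademacherUnit rademacher
  split_ifs <;> rfl

theorem measurable_rademacherUnit (k : ℕ) : Measurable (rademacherUnit k) := by
  have h : Measurable fun z : ℤ => if Even z then (1 : ℤˣ) else -1 := measurable_from_top
  exact h.comp (Int.measurable_floor.comp (measurable_const.mul measurable_id))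

theorem rademacherUnit_succ (k : ℕ) (t : ℝ) :
    rademacherUnit (k + 1) t = rademacherUnit k (2 * t) := by
  unfold rademacherUnit
  rw [pow_succ, mul_assoc]

/-- The index must be positive: at index `0` a unit shift changes the parity of the floor. -/
theorem rademacherUnit_periodic (k : ℕ) : Function.Periodic (rademacherUnit (k + 1)) 1 := by
  intro t
  unfold rademacherUnit
  have h : (2 : ℝ) ^ (k + 1) * (t + 1) = 2 ^ (k + 1) * t + ((2 ^ (k + 1) : ℤ) : ℝ) := by
    push_cast; ring
  have he : Even ((2 : ℤ) ^ (k + 1)) := (even_two).pow_of_ne_zero (Nat.succ_ne_zero k)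
  rw [h, Int.floor_add_intCast]
  simp only [Int.even_add, he, iff_true]

theorem rademacherUnit_one_of_lt {t : ℝ} (h0 : 0 ≤ t) (h1 : t < 1 / 2) :
    rademacherUnit 1 t = 1 := by
  have : ⌊(2 : ℝ) ^ 1 * t⌋ = 0 := Int.floor_eq_iff.2 ⟨by push_cast; linarith, by push_cast; linarith⟩
  rw [rademacherUnit, this]
  rfl

theorem rademacherUnit_one_of_le {t : ℝ} (h0 : 1 / 2 ≤ t) (h1 : t < 1) :
    rademacherUnit 1 t = -1 := by
  have : ⌊(2 : ℝ) ^ 1 * t⌋ = 1 := Int.floor_eq_iff.2 ⟨by push_cast; linarith, by push_cast; linarith⟩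
  rw [rademacherUnit, this]
  rfl

/-- The average of a function over all choices of `n` signs. -/
noncomputable def signAvg {n : ℕ} (f : (Fin n → ℤˣ) → ℝ) : ℝ := (∑ ε, f ε) / 2 ^ n

theorem sum_units_int (f : ℤˣ → ℝ) : ∑ u, f u = f 1 + f (-1) := by
  rw [UnitsInt.univ, Finset.sum_pair (by decide)]

theorem sum_signs_succ {n : ℕ} (f : (Fin (n + 1) → ℤˣ) → ℝ) :
    ∑ ε, f ε = ∑ ε : Fin n → ℤˣ, f (Fin.cons 1 ε) + ∑ ε : Fin n → ℤˣ, f (Fin.cons (-1) ε) := by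
  rw [sum_fin_pi_succ, sum_units_int]

theorem signAvg_nonneg {n : ℕ} {f : (Fin n → ℤˣ) → ℝ} (hf : ∀ ε, 0 ≤ f ε) : 0 ≤ signAvg f :=
  div_nonneg (Finset.sum_nonneg fun ε _ => hf ε) (by positivity)

/-- The values of the first `n` Rademacher functions. -/
noncomputable def rademacherSigns (n : ℕ) (t : ℝ) : Fin n → ℤˣ := fun k => rademacherUnit (k + 1) t

theorem rademacherSigns_periodic (n : ℕ) : Function.Periodic (rademacherSigns n) 1 := fun t =>
  funext fun k => rademacherUnit_periodic k t

/-- Binary self-similarity: doubling `t` drops the first sign. This drives the induction in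
`integral_rademacherSigns`. -/
theorem rademacherSigns_succ (n : ℕ) (t : ℝ) :
    rademacherSigns (n + 1) t = Fin.cons (rademacherUnit 1 t) (rademacherSigns n (2 * t)) := by
  funext k
  refine Fin.cases ?_ (fun k => ?_) k
  · simp [rademacherSigns]
  · simp only [rademacherSigns, Fin.cons_succ, Fin.val_succ]
    exact rademacherUnit_succ _ _

theorem intervalIntegrable_rademacherSigns {n : ℕ} (F : (Fin n → ℤˣ) → ℝ) (a b : ℝ) :
    IntervalIntegrable (fun t => F (rademacherSigns n t)) MeasureTheory.volume a b := by
  have : MeasurableSingletonClass ℤˣ := ⟨fun u => ⟨{(u : ℤ)}, measurableSet_singleton _, by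
    ext v; simp [Units.ext_iff]⟩⟩
  have hm : Measurable fun t => F (rademacherSigns n t) :=
    (measurable_of_finite F).comp (measurable_pi_lambda _ fun k => measurable_rademacherUnit _)
  refine (intervalIntegrable_const (c := ∑ ε, ‖F ε‖)).mono_fun hm.aestronglyMeasurable ?_
  refine Filter.Eventually.of_forall fun t => ?_
  rw [Real.norm_of_nonneg (Finset.sum_nonneg fun ε _ => norm_nonneg _)]
  exact Finset.single_le_sum (f := fun ε => ‖F ε‖) (fun ε _ => norm_nonneg _) (Finset.mem_univ _)

/-- Integrating a function of Rademacher functions amounts to averaging over signs. -/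
theorem integral_rademacherSigns : ∀ (n : ℕ) (F : (Fin n → ℤˣ) → ℝ),
    ∫ t in (0 : ℝ)..1, F (rademacherSigns n t) = signAvg F
  | 0, F => by
    have : ∀ t, F (rademacherSigns 0 t) = F default := fun t => congrArg F (Subsingleton.elim _ _)
    simp only [this, signAvg, Fintype.sum_unique, intervalIntegral.integral_const, sub_zero,
      one_smul, pow_zero, div_one]
    exact congrArg F (Subsingleton.elim _ _)
  | n + 1, F => by
    -- The first sign is constant on each half of the unit interval, while `2 * t` runs through a
    -- full period of the remaining signs.
    have hhalf : ∀ (u : ℤˣ) (a : ℝ),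
        ∫ t in a..(a + 1 / 2), F (Fin.cons u (rademacherSigns n (2 * t))) =
          signAvg (fun ε => F (Fin.cons u ε)) / 2 := by
      intro u a
      have hp : Function.Periodic (fun t => F (Fin.cons u (rademacherSigns n t))) 1 := fun t => by
        simp only [rademacherSigns_periodic n t]
      rw [intervalIntegral.integral_comp_mul_left
        (fun t => F (Fin.cons u (rademacherSigns n t))) two_ne_zero]
      have e : (2 : ℝ) * (a + 1 / 2) = 2 * a + 1 := by ring
      rw [e, hp.intervalIntegral_add_eq (2 * a) 0, zero_add,
        integral_rademacherSigns n (fun ε => F (Fin.cons u ε)), smul_eq_mul, inv_mul_eq_div]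
    rw [← intervalIntegral.integral_add_adjacent_intervals
      (intervalIntegrable_rademacherSigns F 0 (1 / 2))
      (intervalIntegrable_rademacherSigns F (1 / 2) 1)]
    have h1 : ∫ t in (0 : ℝ)..(1 / 2), F (rademacherSigns (n + 1) t) =
        signAvg (fun ε => F (Fin.cons 1 ε)) / 2 := by
      rw [← hhalf 1 0, zero_add]
      refine intervalIntegral.integral_congr_Ioo_of_le (by norm_num) fun t ht => ?_
      simp only [rademacherSigns_succ, rademacherUnit_one_of_lt ht.1.le ht.2]
    have h2 : ∫ t in (1 / 2 : ℝ)..1, F (rademacherSigns (n + 1) t) =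
        signAvg (fun ε => F (Fin.cons (-1) ε)) / 2 := by
      rw [← hhalf (-1) (1 / 2), add_halves]
      refine intervalIntegral.integral_congr_Ioo_of_le (by norm_num) fun t ht => ?_
      simp only [rademacherSigns_succ, rademacherUnit_one_of_le ht.1.le ht.2]
    rw [h1, h2]
    unfold signAvg
    rw [sum_signs_succ, pow_succ]
    field_simp

theorem rademacherNorm_eq_signAvg {X : Type*} [NormedAddCommGroup X] (p : ℝ) {n : ℕ}
    (x : Fin n → X) :
    rademacherNorm p x = (signAvg fun ε : Fin n → ℤˣ => ‖∑ k, ε k • x k‖ ^ p) ^ (1 / p) := by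
  rw [← integral_rademacherSigns]
  simp only [rademacherNorm, rademacherSigns, Units.smul_def, coe_rademacherUnit]

theorem rademacherNorm_nonneg {X : Type*} [NormedAddCommGroup X] (p : ℝ) {n : ℕ}
    (x : Fin n → X) : 0 ≤ rademacherNorm p x := by
  rw [rademacherNorm_eq_signAvg]
  exact Real.rpow_nonneg (signAvg_nonneg fun ε => Real.rpow_nonneg (norm_nonneg _) _) _

end Rademacher

/-! ### Kahane's inequality through a spectral gap on the discrete cube. -/

section Kahane

/-- Change of the sign of the `i`-th coordinate. -/
def flipSign {n : ℕ} (i : Fin n) (ε : Fin n → ℤˣ) : Fin n → ℤˣ := Function.update ε i (-ε i)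

theorem flipSign_zero {n : ℕ} (u : ℤˣ) (ε : Fin n → ℤˣ) :
    flipSign 0 (Fin.cons u ε : Fin (n + 1) → ℤˣ) = Fin.cons (-u) ε := by
  simp [flipSign]

theorem flipSign_succ {n : ℕ} (u : ℤˣ) (ε : Fin n → ℤˣ) (i : Fin n) :
    flipSign i.succ (Fin.cons u ε : Fin (n + 1) → ℤˣ) = Fin.cons u (flipSign i ε) := by
  simp [flipSign, Fin.cons_update]

/-- The Dirichlet form of the discrete cube, up to normalization. -/
def dirichletForm {n : ℕ} (f : (Fin n → ℤˣ) → ℝ) : ℝ :=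
  ∑ ε, f ε * ∑ i, (f ε - f (flipSign i ε))

/-- Flips of later signs stay in one half of the cube. The flip of the first sign joins the halves,
and both ends of such an edge contribute `u * (u - v) + v * (v - u) = (u - v) ^ 2`. -/
theorem dirichletForm_succ {n : ℕ} (f : (Fin (n + 1) → ℤˣ) → ℝ) :
    dirichletForm f = dirichletForm (fun ε => f (Fin.cons 1 ε)) +
      dirichletForm (fun ε => f (Fin.cons (-1) ε)) +
      ∑ ε : Fin n → ℤˣ, (f (Fin.cons 1 ε) - f (Fin.cons (-1) ε)) ^ 2 := by
  unfold dirichletForm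
  rw [sum_signs_succ]
  simp only [Fin.sum_univ_succ, flipSign_zero, flipSign_succ, neg_neg]
  simp only [← Finset.sum_add_distrib]
  exact Finset.sum_congr rfl fun ε _ => by ring

theorem dirichletForm_add_sub {n : ℕ} (f g : (Fin n → ℤˣ) → ℝ) :
    dirichletForm (fun ε => f ε + g ε) + dirichletForm (fun ε => f ε - g ε) =
      2 * dirichletForm f + 2 * dirichletForm g := by
  simp only [dirichletForm, Finset.mul_sum, ← Finset.sum_add_distrib]
  exact Finset.sum_congr rfl fun ε _ => Finset.sum_congr rfl fun i _ => by ring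

/-- The Poincaré inequality on the discrete cube. -/
theorem poincare_signs : ∀ (n : ℕ) (f : (Fin n → ℤˣ) → ℝ),
    2 * (2 ^ n * ∑ ε, f ε ^ 2 - (∑ ε, f ε) ^ 2) ≤ 2 ^ n * dirichletForm f
  | 0, f => by simp [dirichletForm]
  | n + 1, f => by
    have h1 := poincare_signs n (fun ε => f (Fin.cons 1 ε))
    have h2 := poincare_signs n (fun ε => f (Fin.cons (-1) ε))
    -- Cauchy-Schwarz bounds the squared difference of the two half sums by the edges in the new
    -- direction.
    have h3 := sq_sum_le_card_mul_sum_sq (s := (Finset.univ : Finset (Fin n → ℤˣ)))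
      (f := fun ε => f (Fin.cons 1 ε) - f (Fin.cons (-1) ε))
    rw [dirichletForm_succ, sum_signs_succ, sum_signs_succ, pow_succ]
    have hc : ((Finset.univ : Finset (Fin n → ℤˣ)).card : ℝ) = 2 ^ n := by
      simp [Fintype.card_units_int]
    rw [hc, Finset.sum_sub_distrib] at h3
    nlinarith [h1, h2, h3]

/-- The spectral gap inequality of the discrete cube beyond the first level. -/
theorem spectralGap_signs : ∀ (n : ℕ) (f : (Fin n → ℤˣ) → ℝ),
    2 * (2 * (2 ^ n * ∑ ε, f ε ^ 2) - 2 * (∑ ε, f ε) ^ 2 -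
      ∑ i, (∑ ε, f ε * ((ε i : ℤ) : ℝ)) ^ 2) ≤ 2 ^ n * dirichletForm f
  | 0, f => by simp [dirichletForm]
  | n + 1, f => by
    -- The sum and the difference over the first sign carry Walsh degree `0` and `1` in that sign.
    -- The difference has already gained one degree, so Poincaré suffices for it.
    have h1 := spectralGap_signs n (fun ε => f (Fin.cons 1 ε) + f (Fin.cons (-1) ε))
    have h2 := poincare_signs n (fun ε => f (Fin.cons 1 ε) - f (Fin.cons (-1) ε))
    have h3 := dirichletForm_add_sub (fun ε : Fin n → ℤˣ => f (Fin.cons 1 ε))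
      (fun ε => f (Fin.cons (-1) ε))
    have h4 : ∑ ε : Fin n → ℤˣ, (f (Fin.cons 1 ε) + f (Fin.cons (-1) ε)) ^ 2 =
        2 * ∑ ε : Fin n → ℤˣ, f (Fin.cons 1 ε) ^ 2 +
          2 * ∑ ε : Fin n → ℤˣ, f (Fin.cons (-1) ε) ^ 2 -
          ∑ ε : Fin n → ℤˣ, (f (Fin.cons 1 ε) - f (Fin.cons (-1) ε)) ^ 2 := by
      simp only [Finset.mul_sum, ← Finset.sum_add_distrib, ← Finset.sum_sub_distrib]
      exact Finset.sum_congr rfl fun ε _ => by ring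
    rw [dirichletForm_succ, Fin.sum_univ_succ]
    simp only [sum_signs_succ, Fin.cons_zero, Fin.cons_succ, pow_succ (2 : ℝ) n]
    simp only [add_mul, Finset.sum_add_distrib] at h1
    rw [h4] at h1
    rw [Finset.sum_sub_distrib] at h2
    simp only [Units.val_one, Units.val_neg, Int.cast_one, Int.cast_neg, mul_one, mul_neg,
      Finset.sum_neg_distrib]
    have h5 : (2 : ℝ) ^ n * (dirichletForm (fun ε : Fin n → ℤˣ => f (Fin.cons 1 ε) +
        f (Fin.cons (-1) ε)) + dirichletForm (fun ε : Fin n → ℤˣ => f (Fin.cons 1 ε) -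
        f (Fin.cons (-1) ε))) = 2 ^ n * (2 * dirichletForm (fun ε : Fin n → ℤˣ =>
        f (Fin.cons 1 ε)) + 2 * dirichletForm (fun ε : Fin n → ℤˣ => f (Fin.cons (-1) ε))) := by
      rw [h3]
    linarith [h1, h2, h5]

/-- The `L₁`-`L₂` inequality of Latała and Oleszkiewicz for Rademacher sums. -/
theorem sum_signs_norm_sq_le {X : Type*} [NormedAddCommGroup X] [NormedSpace ℝ X] {n : ℕ}
    (x : Fin n → X) :
    2 ^ n * ∑ ε : Fin n → ℤˣ, ‖∑ k, ε k • x k‖ ^ 2 ≤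
      2 * (∑ ε : Fin n → ℤˣ, ‖∑ k, ε k • x k‖) ^ 2 := by
  set f : (Fin n → ℤˣ) → ℝ := fun ε => ‖∑ k, ε k • x k‖ with hf
  have hgap := spectralGap_signs n f
  have heven : ∀ ε, f (-ε) = f ε := fun ε => by simp [hf, Finset.sum_neg_distrib]
  -- Evenness of `f` kills the first-level Walsh coefficients, which yields the improved gap.
  have hodd : ∀ i, ∑ ε, f ε * ((ε i : ℤ) : ℝ) = 0 := by
    intro i
    have h := Fintype.sum_equiv (Equiv.neg (Fin n → ℤˣ)) (fun ε => f ε * ((ε i : ℤ) : ℝ))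
      (fun ε => -(f ε * ((ε i : ℤ) : ℝ))) (fun ε => by simp [heven])
    rw [Finset.sum_neg_distrib] at h
    linarith
  simp only [hodd, ne_eq, OfNat.ofNat_ne_zero, not_false_eq_true, zero_pow,
    Finset.sum_const_zero, sub_zero] at hgap
  have hflip : ∀ ε : Fin n → ℤˣ, ∀ i, ∑ k, flipSign i ε k • x k =
      ∑ k, ε k • x k - (2 : ℝ) • (ε i • x i) := by
    intro ε i
    rw [← Finset.add_sum_erase _ (fun k => flipSign i ε k • x k) (Finset.mem_univ i),
      ← Finset.add_sum_erase _ (fun k => ε k • x k) (Finset.mem_univ i)]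
    have : ∑ k ∈ Finset.univ.erase i, flipSign i ε k • x k =
        ∑ k ∈ Finset.univ.erase i, ε k • x k := Finset.sum_congr rfl fun k hk => by
      rw [flipSign, Function.update_of_ne (Finset.ne_of_mem_erase hk)]
    rw [this]
    simp only [flipSign, Function.update_self, two_smul, Units.neg_smul]
    abel
  have hL : ∀ ε, ∑ i, (f ε - f (flipSign i ε)) ≤ 2 * f ε := by
    intro ε
    -- Each term changes sign in one of the `n` flips, so the flipped vectors add up to `n - 2`
    -- times the original; the triangle inequality then gives `hL`.
    have h1 : ∑ i, ∑ k, flipSign i ε k • x k = ((n : ℝ) - 2) • ∑ k, ε k • x k := by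
      simp only [hflip, Finset.sum_sub_distrib, ← Finset.smul_sum, Finset.sum_const,
        Finset.card_univ, Fintype.card_fin, sub_smul, Nat.cast_smul_eq_nsmul]
    have h2 : ((n : ℝ) - 2) * f ε ≤ ∑ i, f (flipSign i ε) := by
      calc ((n : ℝ) - 2) * f ε ≤ |(n : ℝ) - 2| * f ε :=
            mul_le_mul_of_nonneg_right (le_abs_self _) (norm_nonneg _)
        _ = ‖∑ i, ∑ k, flipSign i ε k • x k‖ := by rw [h1, norm_smul, Real.norm_eq_abs]
        _ ≤ _ := norm_sum_le _ _
    rw [Finset.sum_sub_distrib, Finset.sum_const, Finset.card_univ, Fintype.card_fin,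
      nsmul_eq_mul]
    linarith
  have hQ : dirichletForm f ≤ 2 * ∑ ε, f ε ^ 2 := by
    rw [Finset.mul_sum]
    refine Finset.sum_le_sum fun ε _ => ?_
    have := mul_le_mul_of_nonneg_left (hL ε) (norm_nonneg (∑ k, ε k • x k))
    calc _ ≤ f ε * (2 * f ε) := this
      _ = _ := by ring
  have := mul_le_mul_of_nonneg_left hQ (pow_nonneg zero_le_two n : (0 : ℝ) ≤ 2 ^ n)
  linarith

theorem signAvg_le_rpow {n : ℕ} {f : (Fin n → ℤˣ) → ℝ} (hf : ∀ ε, 0 ≤ f ε) {r : ℝ} (hr : 1 ≤ r) :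
    signAvg f ≤ (signAvg fun ε => f ε ^ r) ^ (1 / r) := by
  have h := Real.arith_mean_le_rpow_mean Finset.univ (fun _ : Fin n → ℤˣ => 1 / (2 : ℝ) ^ n) f
    (fun _ _ => by positivity) (by simp [Fintype.card_units_int]) (fun ε _ => hf ε) hr
  simpa only [← Finset.mul_sum, signAvg, div_eq_inv_mul, mul_one] using h

/-- Provides the admissible constant that makes `kahaneConst` a genuine infimum: `√2` compares `L₂`
with `L₁`, and the power mean inequality replaces `L₁` by `L_r`. -/
theorem isKahaneConst_sqrt_two {𝕜 : Type*} [RCLike 𝕜] {r : ℝ} (hr : 1 ≤ r) :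
    IsKahaneConst 𝕜 r 2 (Real.sqrt 2) := by
  refine ⟨by positivity, fun X _ _ _ n x => ?_⟩
  let : NormedSpace ℝ X := NormedSpace.restrictScalars ℝ 𝕜 X
  rw [rademacherNorm_eq_signAvg, rademacherNorm_eq_signAvg]
  have h1 := sum_signs_norm_sq_le x
  have h2 := signAvg_le_rpow (f := fun ε : Fin n → ℤˣ => ‖∑ k, ε k • x k‖)
    (fun ε => norm_nonneg _) hr
  have h3 : 0 ≤ signAvg fun ε : Fin n → ℤˣ => ‖∑ k, ε k • x k‖ :=
    signAvg_nonneg fun ε => norm_nonneg _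
  have h4 : (signAvg fun ε : Fin n → ℤˣ => ‖∑ k, ε k • x k‖ ^ (2 : ℝ)) ≤
      2 * (signAvg fun ε : Fin n → ℤˣ => ‖∑ k, ε k • x k‖) ^ 2 := by
    simp only [Real.rpow_two, signAvg]
    rw [div_pow, mul_div_assoc', div_le_div_iff₀ (by positivity) (by positivity)]
    nlinarith [pow_pos (zero_lt_two : (0 : ℝ) < 2) n]
  calc _ ≤ (2 * (signAvg fun ε : Fin n → ℤˣ => ‖∑ k, ε k • x k‖) ^ 2) ^ (1 / (2 : ℝ)) :=
        Real.rpow_le_rpow (signAvg_nonneg fun ε => Real.rpow_nonneg (norm_nonneg _) _) h4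
          (by norm_num)
    _ = Real.sqrt 2 * signAvg fun ε : Fin n → ℤˣ => ‖∑ k, ε k • x k‖ := by
        rw [← Real.sqrt_eq_rpow, Real.sqrt_mul zero_le_two, Real.sqrt_sq h3]
    _ ≤ _ := mul_le_mul_of_nonneg_left h2 (Real.sqrt_nonneg 2)

end Kahane

/-! ### Best constants and the iterated cotype inequality. -/

section Constants

/-- Shows that best constants are attained. Nonemptiness is essential because `sInf ∅ = 0`. -/
theorem le_sInf_mul {S : Set ℝ} (hS : S.Nonempty) {a b : ℝ} (hb : 0 ≤ b)
    (h : ∀ c ∈ S, a ≤ c * b) : a ≤ sInf S * b := by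
  rcases hb.eq_or_lt with rfl | hb
  · obtain ⟨c, hc⟩ := hS
    simpa using h c hc
  · rw [← div_le_iff₀ hb]
    exact le_csInf hS fun c hc => (div_le_iff₀ hb).2 (h c hc)

theorem cotypeConst_nonneg (Y : Type*) [NormedAddCommGroup Y] (q : ℝ) : 0 ≤ cotypeConst Y q :=
  Real.sInf_nonneg fun _ h => h.1.le

theorem kahaneConst_nonneg (𝕜 : Type*) [RCLike 𝕜] (p q : ℝ) : 0 ≤ kahaneConst 𝕜 p q :=
  Real.sInf_nonneg fun _ h => h.1.le

theorem constA_nonneg (𝕜 : Type*) [RCLike 𝕜] (Y : Type*) [NormedAddCommGroup Y] (q r : ℝ) :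
    0 ≤ constA 𝕜 Y q r :=
  mul_nonneg (cotypeConst_nonneg Y q) (kahaneConst_nonneg 𝕜 r 2)

theorem HasCotype.le_cotypeConst_mul {Y : Type*} [NormedAddCommGroup Y] {q : ℝ}
    (hY : HasCotype Y q) {n : ℕ} (x : Fin n → Y) :
    (∑ k, ‖x k‖ ^ q) ^ (1 / q) ≤ cotypeConst Y q * rademacherNorm 2 x :=
  le_sInf_mul hY.2 (rademacherNorm_nonneg 2 x) fun _ h => h.2 n x

theorem rademacherNorm_two_le.{v, w} (𝕜 : Type w) [RCLike 𝕜] {Y : Type v} [NormedAddCommGroup Y]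
    [NormedSpace 𝕜 Y] [CompleteSpace Y] {r : ℝ} (hr : 1 ≤ r) {n : ℕ} (x : Fin n → Y) :
    rademacherNorm 2 x ≤ kahaneConst.{v, w} 𝕜 r 2 * rademacherNorm r x :=
  le_sInf_mul ⟨_, isKahaneConst_sqrt_two hr⟩ (rademacherNorm_nonneg r x) fun _ h => h.2 Y n x

/-- The cotype inequality with an `L_r` average in place of the `L₂` average. -/
theorem HasCotype.rpow_sum_le (𝕜 : Type*) [RCLike 𝕜] {Y : Type*} [NormedAddCommGroup Y]
    [NormedSpace 𝕜 Y] [CompleteSpace Y] {q : ℝ} (hY : HasCotype Y q) {r : ℝ} (hr : 1 ≤ r)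
    {n : ℕ} (x : Fin n → Y) :
    (∑ k, ‖x k‖ ^ q) ^ (r / q) ≤
      constA 𝕜 Y q r ^ r * signAvg fun ε : Fin n → ℤˣ => ‖∑ k, ε k • x k‖ ^ r := by
  have hr0 : 0 < r := by linarith
  have h0 : 0 ≤ ∑ k, ‖x k‖ ^ q := Finset.sum_nonneg fun k _ => Real.rpow_nonneg (norm_nonneg _) _
  have h : (∑ k, ‖x k‖ ^ q) ^ (1 / q) ≤ constA 𝕜 Y q r * rademacherNorm r x := by
    refine (hY.le_cotypeConst_mul x).trans ?_
    rw [constA, mul_assoc]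
    exact mul_le_mul_of_nonneg_left (rademacherNorm_two_le 𝕜 hr x) (cotypeConst_nonneg Y q)
  have h' := Real.rpow_le_rpow (Real.rpow_nonneg h0 _) h hr0.le
  rw [← Real.rpow_mul h0, one_div_mul_eq_div,
    Real.mul_rpow (constA_nonneg 𝕜 Y q r) (rademacherNorm_nonneg r x),
    rademacherNorm_eq_signAvg, one_div, Real.rpow_inv_rpow (signAvg_nonneg fun ε =>
      Real.rpow_nonneg (norm_nonneg _) _) hr0.ne'] at h'
  exact h'

/-- The iterated cotype inequality for families with several indices. -/
theorem HasCotype.rpow_sum_multi_le (𝕜 : Type*) [RCLike 𝕜] {Y : Type*} [NormedAddCommGroup Y]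
    [NormedSpace 𝕜 Y] [CompleteSpace Y] {q : ℝ} (hY : HasCotype Y q) {r : ℝ} (hr : 1 ≤ r)
    (hrq : r ≤ q) {N : ℕ} : ∀ (d : ℕ) (y : (Fin d → Fin N) → Y),
    (∑ i, ‖y i‖ ^ q) ^ (r / q) ≤ (constA 𝕜 Y q r ^ r) ^ d *
      ((∑ ε : Fin d → Fin N → ℤˣ, ‖∑ i, (∏ l, ε l (i l)) • y i‖ ^ r) / (2 ^ N) ^ d)
  | 0, y => by
    have hq0 : q ≠ 0 := by linarith
    simp [← Real.rpow_mul (norm_nonneg _), mul_div_cancel₀ r hq0]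
  | d + 1, y => by
    have hr0 : 0 < r := by linarith
    have hq0 : 0 < q := by linarith
    set A := constA 𝕜 Y q r ^ r with hA
    have hA0 : 0 ≤ A := Real.rpow_nonneg (constA_nonneg 𝕜 Y q r) _
    set c : ℝ := A ^ d / (2 ^ N) ^ d with hc
    have hc0 : 0 ≤ c := by positivity
    -- Random sum over the last `d` indices, the first index being `j` and the signs `ε` fixed.
    set b : Fin N → (Fin d → Fin N → ℤˣ) → Y := fun j ε =>
      ∑ i : Fin d → Fin N, (∏ l, ε l (i l)) • y (Fin.cons j i) with hb
    have hsum0 : ∀ j, 0 ≤ ∑ i : Fin d → Fin N, ‖y (Fin.cons j i)‖ ^ q := fun j =>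
      Finset.sum_nonneg fun i _ => Real.rpow_nonneg (norm_nonneg _) _
    have hb0 : ∀ j, 0 ≤ ∑ ε, ‖b j ε‖ ^ r := fun j =>
      Finset.sum_nonneg fun ε _ => Real.rpow_nonneg (norm_nonneg _) _
    have h1 : ∀ j, ∑ i : Fin d → Fin N, ‖y (Fin.cons j i)‖ ^ q ≤
        c ^ (q / r) * (∑ ε, ‖b j ε‖ ^ r) ^ (q / r) := by
      intro j
      have h := Real.rpow_le_rpow (Real.rpow_nonneg (hsum0 j) _)
        (HasCotype.rpow_sum_multi_le 𝕜 hY hr hrq d (fun i => y (Fin.cons j i)))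
        (div_nonneg hq0.le hr0.le)
      rw [← Real.rpow_mul (hsum0 j), div_mul_div_cancel₀ hq0.ne', div_self hr0.ne',
        Real.rpow_one] at h
      refine h.trans (le_of_eq ?_)
      rw [← Real.mul_rpow hc0 (hb0 j)]
      congr 1
      simp only [hc, hb]
      ring
    -- After the induction hypothesis for each `j`, Minkowski pulls the sum over signs out of the
    -- `ℓ_q` sum over `j`; `h3` then applies cotype in the first index for fixed `ε`.
    have h2 : (∑ j, ∑ i : Fin d → Fin N, ‖y (Fin.cons j i)‖ ^ q) ^ (r / q) ≤
        c * ∑ ε, (∑ j, ‖b j ε‖ ^ q) ^ (r / q) := by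
      have hB0 : 0 ≤ ∑ j, (∑ ε, ‖b j ε‖ ^ r) ^ (q / r) :=
        Finset.sum_nonneg fun j _ => Real.rpow_nonneg (hb0 j) _
      calc _ ≤ (c ^ (q / r) * ∑ j, (∑ ε, ‖b j ε‖ ^ r) ^ (q / r)) ^ (r / q) := by
            rw [Finset.mul_sum]
            exact Real.rpow_le_rpow (Finset.sum_nonneg fun j _ => hsum0 j)
              (Finset.sum_le_sum fun j _ => h1 j) (div_nonneg hr0.le hq0.le)
        _ = c * (∑ j, (∑ ε, ‖b j ε‖ ^ r) ^ (q / r)) ^ (r / q) := by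
            rw [Real.mul_rpow (Real.rpow_nonneg hc0 _) hB0, ← Real.rpow_mul hc0,
              div_mul_div_cancel₀ hr0.ne', div_self hq0.ne', Real.rpow_one]
        _ ≤ _ := mul_le_mul_of_nonneg_left (rpow_sum_sum_rpow_le_of_le Finset.univ Finset.univ
            hr0 hrq (fun j ε => ‖b j ε‖) fun j ε => norm_nonneg _) hc0
    have h3 : ∀ ε, (∑ j, ‖b j ε‖ ^ q) ^ (r / q) ≤ A *
        signAvg fun δ : Fin N → ℤˣ => ‖∑ j, δ j • b j ε‖ ^ r := fun ε =>
      hY.rpow_sum_le 𝕜 hr _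
    rw [sum_fin_pi_succ (fun _ => Fin N)]
    refine (h2.trans (mul_le_mul_of_nonneg_left (Finset.sum_le_sum fun ε _ => h3 ε) hc0)).trans
      (le_of_eq ?_)
    rw [sum_fin_pi_succ (fun _ => Fin N → ℤˣ), Finset.sum_comm]
    simp only [sum_fin_pi_succ (fun _ : Fin (d + 1) => Fin N), Fin.prod_univ_succ, Fin.cons_zero,
      Fin.cons_succ, mul_smul, ← Finset.smul_sum, ← Finset.mul_sum, signAvg, ← Finset.sum_div]
    simp only [hc, hb]
    ring

end Constants

/-! ### Uniform boundedness for multilinear maps. -/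

section UniformBoundedness

/-- The uniform boundedness principle for multilinear maps on Banach spaces, with weights. -/
theorem exists_uniform_bound {𝕜 : Type*} [RCLike 𝕜] {ι : Type*} [Fintype ι]
    {E : ι → Type*} [∀ i, NormedAddCommGroup (E i)] [∀ i, NormedSpace 𝕜 (E i)]
    [∀ i, CompleteSpace (E i)] {α : Type*} {F : α → Type*} [∀ a, NormedAddCommGroup (F a)]
    [∀ a, NormedSpace 𝕜 (F a)] (T : ∀ a, ContinuousMultilinearMap 𝕜 E (F a)) (w : α → ℝ)
    (hT : ∀ z, ∃ c : ℝ, ∀ a, ‖T a z‖ ≤ c * w a) (hw : ∀ a, 0 ≤ w a) :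
    ∃ M : ℝ, 0 ≤ M ∧ ∀ a z, ‖T a z‖ ≤ M * (∏ i, ‖z i‖) * w a := by
  classical
  -- Baire category: the closed sets of uniform boundedness cover the product, so one of them
  -- contains a ball around some `z₀`.
  obtain ⟨n, z₀, hz₀⟩ := nonempty_interior_of_iUnion_of_closed
    (f := fun n : ℕ => {z : ∀ i, E i | ∀ a, ‖T a z‖ ≤ n * w a})
    (fun n => by
      simp only [Set.ofPred_forall]
      exact isClosed_iInter fun a => isClosed_le (T a).cont.norm continuous_const)
    (Set.eq_univ_of_forall fun z => by
      obtain ⟨c, hc⟩ := hT z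
      obtain ⟨n, hn⟩ := exists_nat_ge c
      exact Set.mem_iUnion.2 ⟨n, fun a => (hc a).trans (mul_le_mul_of_nonneg_right hn (hw a))⟩)
  obtain ⟨δ, hδ, hball⟩ := Metric.mem_nhds_iff.1 (mem_interior_iff_mem_nhds.1 hz₀)
  have hsmall : ∀ a (z : ∀ i, E i), (∀ i, ‖z i‖ < δ) →
      ‖T a z‖ ≤ 2 ^ Fintype.card ι * (n * w a) := by
    intro a z hz
    -- Expanding at `z = (z₀ + z) + (-z₀)` gives `2 ^ card ι` terms. Up to signs, which leave the
    -- norm unchanged, each is evaluated inside the ball.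
    have hpiece : ∀ s : Finset ι, ‖T a (s.piecewise (z₀ + z) (-z₀))‖ ≤ n * w a := by
      intro s
      have e : s.piecewise (z₀ + z) (-z₀) =
          fun i => (if i ∈ s then (1 : 𝕜) else -1) • s.piecewise (z₀ + z) z₀ i := by
        funext i
        by_cases hi : i ∈ s <;> simp [hi]
      have h1 : ‖∏ i, (if i ∈ s then (1 : 𝕜) else -1)‖ = 1 := by
        rw [norm_prod]
        refine Finset.prod_eq_one fun i _ => ?_
        split_ifs <;> simp
      rw [e, ContinuousMultilinearMap.map_smul_univ, norm_smul, h1, one_mul]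
      refine hball ?_ a
      rw [Metric.mem_ball, dist_pi_lt_iff hδ]
      intro i
      by_cases hi : i ∈ s
      · simpa [hi] using hz i
      · simpa [hi] using hδ
    have hz' : z = (z₀ + z) + (-z₀) := by abel
    rw [hz', ContinuousMultilinearMap.map_add_univ]
    refine (norm_sum_le _ _).trans ((Finset.sum_le_sum fun s _ => hpiece s).trans (le_of_eq ?_))
    simp
  refine ⟨(2 / δ) ^ Fintype.card ι * (2 ^ Fintype.card ι * n), by positivity, fun a z => ?_⟩
  by_cases hz : ∃ i, z i = 0
  · obtain ⟨i, hi⟩ := hz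
    rw [(T a).map_coord_zero i hi, norm_zero]
    have := hw a
    positivity
  push Not at hz
  have hzp : ∀ i, 0 < ‖z i‖ := fun i => norm_pos_iff.2 (hz i)
  -- Rescaling every coordinate to norm `δ / 2` needs nonzero coordinates, hence the preceding case
  -- split.
  have h := hsmall a (fun i => ((δ / 2 / ‖z i‖ : ℝ) : 𝕜) • z i) fun i => by
    rw [norm_smul, RCLike.norm_ofReal, abs_of_pos (by have := hzp i; positivity),
      div_mul_cancel₀ _ (hzp i).ne']
    linarith
  have hc : ‖∏ i, ((δ / 2 / ‖z i‖ : ℝ) : 𝕜)‖ = (δ / 2) ^ Fintype.card ι / ∏ i, ‖z i‖ := by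
    rw [norm_prod, ← Finset.card_univ, ← Finset.prod_const, ← Finset.prod_div_distrib]
    refine Finset.prod_congr rfl fun i _ => ?_
    rw [RCLike.norm_ofReal, abs_of_pos (by have := hzp i; positivity)]
  have hP : 0 < ∏ i, ‖z i‖ := Finset.prod_pos fun i _ => hzp i
  rw [ContinuousMultilinearMap.map_smul_univ, norm_smul, hc, div_mul_eq_mul_div,
    div_le_iff₀ hP] at h
  have hk : (2 / δ) ^ Fintype.card ι * (δ / 2) ^ Fintype.card ι = 1 := by
    rw [← mul_pow, div_mul_div_cancel₀ hδ.ne', div_self two_ne_zero, one_pow]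
  calc ‖T a z‖ = (2 / δ) ^ Fintype.card ι * ((δ / 2) ^ Fintype.card ι * ‖T a z‖) := by
        rw [← mul_assoc, hk, one_mul]
    _ ≤ (2 / δ) ^ Fintype.card ι * (2 ^ Fintype.card ι * (n * w a) * ∏ i, ‖z i‖) :=
        mul_le_mul_of_nonneg_left h (by positivity)
    _ = _ := by ring

end UniformBoundedness

/-! ### The weak `ℓ₁`-norm. -/

section WeakNorm

variable {𝕜 : Type*} [RCLike 𝕜] {X : Type*} [NormedAddCommGroup X] [NormedSpace 𝕜 X] {N : ℕ}

theorem weakL1Norm_nonneg (x : Fin N → X) : 0 ≤ weakL1Norm 𝕜 x :=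
  Real.iSup_nonneg fun _ => Finset.sum_nonneg fun _ _ => norm_nonneg _

theorem sum_norm_apply_le_weakL1Norm (x : Fin N → X) (φ : X →L[𝕜] 𝕜) (hφ : ‖φ‖ ≤ 1) :
    ∑ i, ‖φ (x i)‖ ≤ weakL1Norm 𝕜 x := by
  refine le_ciSup (f := fun φ : {φ : X →L[𝕜] 𝕜 // ‖φ‖ ≤ 1} => ∑ i, ‖φ.1 (x i)‖) ?_ ⟨φ, hφ⟩
  refine ⟨∑ i, ‖x i‖, ?_⟩
  rintro _ ⟨ψ, rfl⟩
  exact Finset.sum_le_sum fun i _ => ψ.1.le_of_opNorm_le ψ.2 (x i) |>.trans_eq (one_mul _)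

/-- A norming functional from Hahn-Banach, whose absolute values on the terms ignore the signs. -/
theorem norm_sum_signs_le_weakL1Norm (x : Fin N → X) (ε : Fin N → ℤˣ) :
    ‖∑ i, ε i • x i‖ ≤ weakL1Norm 𝕜 x := by
  obtain ⟨φ, hφ, hφx⟩ := exists_dual_vector'' 𝕜 (∑ i, ε i • x i)
  refine le_trans ?_ (sum_norm_apply_le_weakL1Norm x φ hφ)
  calc ‖∑ i, ε i • x i‖ = ‖φ (∑ i, ε i • x i)‖ := by rw [hφx]; simp
    _ ≤ ∑ i, ‖φ (ε i • x i)‖ := by rw [map_sum]; exact norm_sum_le _ _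
    _ = ∑ i, ‖φ (x i)‖ := Finset.sum_congr rfl fun i _ => by
      rcases Int.units_eq_one_or (ε i) with h | h <;> simp [h, Units.smul_def]

end WeakNorm

/-! ### Summing norms and finiteness of `blockNorm`. -/

section Summing

variable {𝕜 : Type*} [RCLike 𝕜] {ι : Type*} [Fintype ι] [DecidableEq ι]
  {X : ι → Type*} [∀ i, NormedAddCommGroup (X i)] [∀ i, NormedSpace 𝕜 (X i)]
  {Y : Type*} [NormedAddCommGroup Y] [NormedSpace 𝕜 Y]

omit [DecidableEq ι] in
theorem prod_weakL1Norm_nonneg {N : ℕ} (x : ∀ k, Fin N → X k) : 0 ≤ ∏ k, weakL1Norm 𝕜 (x k) :=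
  Finset.prod_nonneg fun _ _ => weakL1Norm_nonneg _

theorem summingNorm_nonneg (r : ℝ) (V : ContinuousMultilinearMap 𝕜 X Y) : 0 ≤ summingNorm r V :=
  Real.sInf_nonneg fun _ h => h.1.le

theorem IsMultipleSumming.le_summingNorm_mul {r : ℝ} {V : ContinuousMultilinearMap 𝕜 X Y}
    (hV : IsMultipleSumming r V) {N : ℕ} (x : ∀ k, Fin N → X k) :
    (∑ i : ι → Fin N, ‖V (fun k => x k (i k))‖ ^ r) ^ (1 / r) ≤
      summingNorm r V * ∏ k, weakL1Norm 𝕜 (x k) :=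
  le_sInf_mul hV (prod_weakL1Norm_nonneg x) fun _ h => h.2 N x

theorem summingNorm_le {r c : ℝ} (hc : 0 ≤ c) {V : ContinuousMultilinearMap 𝕜 X Y}
    (h : ∀ (N : ℕ) (x : ∀ k, Fin N → X k),
      (∑ i : ι → Fin N, ‖V (fun k => x k (i k))‖ ^ r) ^ (1 / r) ≤
        c * ∏ k, weakL1Norm 𝕜 (x k)) : summingNorm r V ≤ c := by
  -- Admissible constants are strictly positive, so `c = 0` is reached only through `c + δ`.
  refine le_of_forall_pos_le_add fun δ hδ => ?_
  refine csInf_le ⟨0, fun _ h => h.1.le⟩ ⟨by positivity, fun N x => (h N x).trans ?_⟩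
  exact mul_le_mul_of_nonneg_right (by linarith) (prod_weakL1Norm_nonneg x)

/-- The map `z ↦ U^D_z(x)` for fixed `x`. -/
noncomputable def restrictCompl (U : ContinuousMultilinearMap 𝕜 X Y) (D : Finset ι)
    (x : ∀ i : {i // i ∈ D}, X i) :
    ContinuousMultilinearMap 𝕜 (fun i : {i // i ∉ D} => X i) Y where
  toMultilinearMap := U.toMultilinearMap.domDomRestrict (fun i => i ∉ D)
    (fun i => x ⟨i, not_not.1 i.2⟩)
  cont := by
    change Continuous fun z : (∀ i : {i // i ∉ D}, X i) =>
      U (fun j => if h : j ∉ D then z ⟨j, h⟩ else x ⟨j, not_not.1 h⟩)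
    refine U.cont.comp (continuous_pi fun j => ?_)
    by_cases h : j ∈ D
    · simpa [h] using continuous_const
    · simpa [h] using continuous_apply (⟨j, h⟩ : {i // i ∉ D})

omit [Fintype ι] in
theorem restrictTo_apply (U : ContinuousMultilinearMap 𝕜 X Y) (D : Finset ι)
    (z : ∀ i : {i // i ∉ D}, X i) (x : ∀ i : {i // i ∈ D}, X i) :
    restrictTo U D z x = U (fun j => if h : j ∈ D then x ⟨j, h⟩ else z ⟨j, h⟩) := rfl

omit [Fintype ι] in
theorem restrictCompl_apply (U : ContinuousMultilinearMap 𝕜 X Y) (D : Finset ι)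
    (z : ∀ i : {i // i ∉ D}, X i) (x : ∀ i : {i // i ∈ D}, X i) :
    restrictCompl U D x z = restrictTo U D z x := by
  change U (fun j => if h : j ∉ D then z ⟨j, h⟩ else x ⟨j, not_not.1 h⟩) = _
  rw [restrictTo_apply]
  congr 1
  funext j
  by_cases h : j ∈ D <;> simp [h]

variable [∀ i, CompleteSpace (X i)]

/-- The multilinear map `z ↦ U^D_z` into the space of multiple summing maps is bounded. -/
theorem IsMultipleSummingIn.exists_bound {r : ℝ} (hr : 1 ≤ r) {U : ContinuousMultilinearMap 𝕜 X Y}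
    {D : Finset ι} (hU : IsMultipleSummingIn r U D) :
    ∃ M : ℝ, 0 ≤ M ∧ ∀ z : ∀ i : {i // i ∉ D}, X i,
      summingNorm r (restrictTo U D z) ≤ M * ∏ i, ‖z i‖ := by
  have hr0 : 0 < r := by linarith
  have : Fact (1 ≤ ENNReal.ofReal r) := ⟨by simpa using hr⟩
  have htr : (ENNReal.ofReal r).toReal = r := ENNReal.toReal_ofReal hr0.le
  -- Every finite family `x` gives a continuous multilinear map from `z` to the `ℓ_r` space of
  -- values of `U^D_z` on `x`. Summability in `D` bounds these maps pointwise in `z`, with weight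
  -- the product of the weak norms, and uniform boundedness gives `M`.
  let α := Σ N : ℕ, ∀ k : {i // i ∈ D}, Fin N → X k
  let T : ∀ a : α, ContinuousMultilinearMap 𝕜 (fun i : {i // i ∉ D} => X i)
      (PiLp (ENNReal.ofReal r) fun _ : {i // i ∈ D} → Fin a.1 => Y) := fun a =>
    ((PiLp.continuousLinearEquiv (ENNReal.ofReal r) 𝕜
      (fun _ : {i // i ∈ D} → Fin a.1 => Y)).symm.toContinuousLinearMap).compContinuousMultilinearMap
      (ContinuousMultilinearMap.pi fun i : {i // i ∈ D} → Fin a.1 =>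
        restrictCompl U D fun k => a.2 k (i k))
  have hnorm : ∀ a z, ‖T a z‖ = (∑ i : {i // i ∈ D} → Fin a.1,
      ‖restrictTo U D z (fun k => a.2 k (i k))‖ ^ r) ^ (1 / r) := by
    intro a z
    rw [PiLp.norm_eq_sum (by rw [htr]; exact hr0), htr]
    simp only [← restrictCompl_apply]
    rfl
  obtain ⟨M, hM, h⟩ := exists_uniform_bound T (fun a => ∏ k, weakL1Norm 𝕜 (a.2 k))
    (fun z => ⟨summingNorm r (restrictTo U D z), fun a => by
      rw [hnorm]
      exact (hU z).le_summingNorm_mul a.2⟩) (fun a => prod_weakL1Norm_nonneg a.2)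
  refine ⟨M, hM, fun z => summingNorm_le (by positivity) fun N x => ?_⟩
  have := h ⟨N, x⟩ z
  rwa [hnorm] at this

omit [∀ i, CompleteSpace (X i)] in
theorem blockNorm_nonneg (r : ℝ) (U : ContinuousMultilinearMap 𝕜 X Y) (D : Finset ι) :
    0 ≤ blockNorm r U D :=
  Real.sInf_nonneg fun _ h => h.1

theorem IsMultipleSummingIn.summingNorm_le_blockNorm_mul {r : ℝ} (hr : 1 ≤ r)
    {U : ContinuousMultilinearMap 𝕜 X Y} {D : Finset ι} (hU : IsMultipleSummingIn r U D)
    (z : ∀ i : {i // i ∉ D}, X i) :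
    summingNorm r (restrictTo U D z) ≤ blockNorm r U D * ∏ i, ‖z i‖ :=
  le_sInf_mul (hU.exists_bound hr) (Finset.prod_nonneg fun _ _ => norm_nonneg _)
    fun _ h => h.2 z

end Summing

/-! ### The endpoint estimate for one block. -/

section Blocks

/-- The iterated cotype inequality with indices in an arbitrary finite type. -/
theorem HasCotype.rpow_sum_pi_le (𝕜 : Type*) [RCLike 𝕜] {Y : Type*} [NormedAddCommGroup Y]
    [NormedSpace 𝕜 Y] [CompleteSpace Y] {q : ℝ} (hY : HasCotype Y q) {r : ℝ} (hr : 1 ≤ r)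
    (hrq : r ≤ q) {N : ℕ} {κ : Type*} [Fintype κ] [DecidableEq κ] (y : (κ → Fin N) → Y) :
    (∑ i, ‖y i‖ ^ q) ^ (r / q) ≤ (constA 𝕜 Y q r ^ r) ^ Fintype.card κ *
      ((∑ ε : κ → Fin N → ℤˣ, ‖∑ i, (∏ l, ε l (i l)) • y i‖ ^ r) /
        (2 ^ N) ^ Fintype.card κ) := by
  set e := Fintype.equivFin κ
  have h := hY.rpow_sum_multi_le 𝕜 hr hrq (Fintype.card κ)
    (fun i : Fin (Fintype.card κ) → Fin N => y (fun l => i (e l)))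
  have h1 : ∑ i : Fin (Fintype.card κ) → Fin N, ‖y (fun l => i (e l))‖ ^ q = ∑ i, ‖y i‖ ^ q :=
    Fintype.sum_equiv (e.arrowCongr (Equiv.refl (Fin N))).symm _ _ fun _ => rfl
  have h2 : ∑ ε : Fin (Fintype.card κ) → Fin N → ℤˣ,
      ‖∑ i : Fin (Fintype.card κ) → Fin N, (∏ l, ε l (i l)) • y (fun l => i (e l))‖ ^ r =
      ∑ ε : κ → Fin N → ℤˣ, ‖∑ i, (∏ l, ε l (i l)) • y i‖ ^ r := by
    refine Fintype.sum_equiv (e.arrowCongr (Equiv.refl (Fin N → ℤˣ))).symm _ _ fun ε => ?_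
    congr 2
    refine Fintype.sum_equiv (e.arrowCongr (Equiv.refl (Fin N))).symm _ _ fun i => ?_
    congr 1
    exact (Fintype.prod_equiv e _ _ fun l => rfl).symm
  rwa [h1, h2] at h

variable {𝕜 : Type*} [RCLike 𝕜] {ι : Type*} [Fintype ι] [DecidableEq ι]
  {X : ι → Type*} [∀ i, NormedAddCommGroup (X i)] [∀ i, NormedSpace 𝕜 (X i)]
  {Y : Type*} [NormedAddCommGroup Y] [NormedSpace 𝕜 Y]

/-- Turns the multiple random sum of the cotype inequality into one value of `V` at Rademacher sums.
-/
theorem map_sum_signs (V : ContinuousMultilinearMap 𝕜 X Y) {N : ℕ}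
    (x : ∀ l, Fin N → X l) (ε : ι → Fin N → ℤˣ) :
    V (fun l => ∑ j, ε l j • x l j) =
      ∑ i : ι → Fin N, (∏ l, ε l (i l)) • V (fun l => x l (i l)) := by
  rw [ContinuousMultilinearMap.map_sum]
  refine Finset.sum_congr rfl fun i _ => ?_
  have h : (fun l => ε l (i l) • x l (i l)) =
      fun l => (((ε l (i l) : ℤˣ) : ℤ) : 𝕜) • x l (i l) := by
    funext l
    rw [Int.cast_smul_eq_zsmul, Units.smul_def]
  rw [h, ContinuousMultilinearMap.map_smul_univ, ← Int.cast_prod, Int.cast_smul_eq_zsmul,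
    Units.smul_def, Units.coe_prod]

variable [∀ i, CompleteSpace (X i)] [CompleteSpace Y]

/-- The mixed `(r, q)` inequality for a map that is multiple `(r,1)`-summing in `D`, with the
indices in `D` summed outermost. -/
theorem IsMultipleSummingIn.sum_rpow_le {q r : ℝ} (hY : HasCotype Y q) (hr : 1 ≤ r)
    (hrq : r ≤ q) {U : ContinuousMultilinearMap 𝕜 X Y} {D : Finset ι}
    (hU : IsMultipleSummingIn r U D) {N : ℕ} (x : ∀ l, Fin N → X l)
    (hx : ∀ l, weakL1Norm 𝕜 (x l) ≤ 1) :
    (∑ j : {l // l ∈ D} → Fin N, (∑ i : {l // l ∉ D} → Fin N,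
      ‖U (fun l => x l (if h : l ∈ D then j ⟨l, h⟩ else i ⟨l, h⟩))‖ ^ q) ^ (r / q)) ^ (1 / r) ≤
      constA 𝕜 Y q r ^ Dᶜ.card * blockNorm r U D := by
  have hr0 : 0 < r := by linarith
  set A := constA 𝕜 Y q r with hA
  have hA0 : 0 ≤ A := constA_nonneg 𝕜 Y q r
  set B := blockNorm r U D with hB
  have hB0 : 0 ≤ B := blockNorm_nonneg r U D
  set d := Fintype.card {l // l ∉ D} with hd
  have hcard : Dᶜ.card = d := by
    rw [hd, Fintype.card_subtype]
    congr 1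
    ext l
    simp
  let z : ({l // l ∉ D} → Fin N → ℤˣ) → ∀ l : {l // l ∉ D}, X l := fun ε l =>
    ∑ j, ε l j • x l j
  have hz : ∀ ε, ∏ l, ‖z ε l‖ ≤ 1 := fun ε => Finset.prod_le_one (fun l _ => norm_nonneg _)
    fun l _ => (norm_sum_signs_le_weakL1Norm (𝕜 := 𝕜) (x l) (ε l)).trans (hx l)
  -- Uniform in the signs, since the random points `z ε` have coordinates of norm at most `1`.
  have hblock : ∀ ε, ∑ j : {l // l ∈ D} → Fin N,
      ‖restrictTo U D (z ε) (fun l => x l (j l))‖ ^ r ≤ B ^ r := by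
    intro ε
    have h0 : 0 ≤ ∑ j : {l // l ∈ D} → Fin N, ‖restrictTo U D (z ε) (fun l => x l (j l))‖ ^ r :=
      Finset.sum_nonneg fun j _ => Real.rpow_nonneg (norm_nonneg _) _
    have h1 := (hU (z ε)).le_summingNorm_mul (fun l j => x l j)
    have h2 : summingNorm r (restrictTo U D (z ε)) ≤ B :=
      (hU.summingNorm_le_blockNorm_mul hr (z ε)).trans (mul_le_of_le_one_right hB0 (hz ε))
    have h3 : ∏ l : {l // l ∈ D}, weakL1Norm 𝕜 (x l) ≤ 1 :=
      Finset.prod_le_one (fun l _ => weakL1Norm_nonneg _) fun l _ => hx l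
    have h4 := h1.trans ((mul_le_of_le_one_right (summingNorm_nonneg _ _) h3).trans h2)
    have h5 := Real.rpow_le_rpow (Real.rpow_nonneg h0 _) h4 hr0.le
    rwa [one_div, Real.rpow_inv_rpow h0 hr0.ne'] at h5
  have hcot : ∀ j : {l // l ∈ D} → Fin N, (∑ i : {l // l ∉ D} → Fin N,
      ‖U (fun l => x l (if h : l ∈ D then j ⟨l, h⟩ else i ⟨l, h⟩))‖ ^ q) ^ (r / q) ≤
      (A ^ r) ^ d * ((∑ ε : {l // l ∉ D} → Fin N → ℤˣ,
        ‖restrictTo U D (z ε) (fun l => x l (j l))‖ ^ r) / (2 ^ N) ^ d) := by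
    intro j
    have h := hY.rpow_sum_pi_le 𝕜 hr hrq (fun i : {l // l ∉ D} → Fin N =>
      restrictCompl U D (fun l => x l (j l)) (fun l => x l (i l)))
    simp only [← map_sum_signs
      (restrictCompl U D fun l => x l (j l)) (fun l => x l)] at h
    simp only [restrictCompl_apply] at h
    refine le_of_eq_of_le ?_ h
    congr 1
    refine Finset.sum_congr rfl fun i _ => ?_
    rw [restrictTo_apply]
    congr 3
    funext l
    by_cases hl : l ∈ D <;> simp [hl]
  -- Exchanging the sum over `j` with the sign average allows `hblock` for each `ε`; the `(2 ^ N) ^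
  -- d` choices of signs cancel the normalization.
  have hsum : ∑ j : {l // l ∈ D} → Fin N, (∑ i : {l // l ∉ D} → Fin N,
      ‖U (fun l => x l (if h : l ∈ D then j ⟨l, h⟩ else i ⟨l, h⟩))‖ ^ q) ^ (r / q) ≤
      (A ^ d * B) ^ r := by
    calc _ ≤ ∑ j : {l // l ∈ D} → Fin N, (A ^ r) ^ d * ((∑ ε : {l // l ∉ D} → Fin N → ℤˣ,
            ‖restrictTo U D (z ε) (fun l => x l (j l))‖ ^ r) / (2 ^ N) ^ d) :=
          Finset.sum_le_sum fun j _ => hcot j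
      _ = (A ^ r) ^ d * ((∑ ε : {l // l ∉ D} → Fin N → ℤˣ, ∑ j : {l // l ∈ D} → Fin N,
            ‖restrictTo U D (z ε) (fun l => x l (j l))‖ ^ r) / (2 ^ N) ^ d) := by
          rw [← Finset.mul_sum, ← Finset.sum_div, Finset.sum_comm]
      _ ≤ (A ^ r) ^ d * ((∑ ε : {l // l ∉ D} → Fin N → ℤˣ, B ^ r) / (2 ^ N) ^ d) := by
          gcongr with ε
          exact hblock ε
      _ = (A ^ d * B) ^ r := by
          have hN : (2 : ℝ) ^ N ≠ 0 := by positivity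
          rw [Finset.sum_const, Finset.card_univ, nsmul_eq_mul, Real.mul_rpow (by positivity) hB0,
            ← Real.rpow_natCast, ← Real.rpow_natCast A, ← Real.rpow_mul hA0,
            ← Real.rpow_mul hA0, mul_comm r]
          have : ((Fintype.card ({l // l ∉ D} → Fin N → ℤˣ) : ℕ) : ℝ) = (2 ^ N) ^ d := by
            simp [Fintype.card_units_int, hd]
          rw [this, mul_div_cancel_left₀ _ (pow_ne_zero _ hN)]
  rw [hcard]
  refine (Real.rpow_le_rpow (Finset.sum_nonneg fun j _ => Real.rpow_nonneg (Finset.sum_nonneg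
    fun i _ => Real.rpow_nonneg (norm_nonneg _) _) _) hsum (one_div_nonneg.2 hr0.le)).trans
    (le_of_eq ?_)
  rw [one_div, Real.rpow_rpow_inv (by positivity) hr0.ne']

end Blocks

/-! ### Multi-indices split along a partition. -/

section Glue

variable {m n N : ℕ} {C : Fin n → Finset (Fin m)}

/-- `glue` picks a block containing `l` by choice; disjointness leaves only one candidate. -/
theorem glue_apply (hC : ∀ l, ∃ k, l ∈ C k) (hdisj : ∀ j k, j ≠ k → Disjoint (C j) (C k))
    (t : ∀ k, {l // l ∈ C k} → Fin N) {l : Fin m} {k : Fin n} (h : l ∈ C k) :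
    glue C hC t l = t k ⟨l, h⟩ := by
  have key : ∀ (k' : Fin n) (h' : l ∈ C k'), t k' ⟨l, h'⟩ = t k ⟨l, h⟩ := by
    intro k' h'
    obtain rfl : k' = k := by
      by_contra hne
      exact Finset.disjoint_left.1 (hdisj k' k hne) h' h
    rfl
  exact key _ _

/-- Gluing is a bijection for a partition. -/
noncomputable def glueEquiv (hC : ∀ l, ∃ k, l ∈ C k)
    (hdisj : ∀ j k, j ≠ k → Disjoint (C j) (C k)) :
    (∀ k, {l // l ∈ C k} → Fin N) ≃ (Fin m → Fin N) where
  toFun := glue C hC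
  invFun i := fun _ l => i l
  left_inv t := by
    funext k l
    exact glue_apply hC hdisj t l.2
  right_inv i := rfl

-- Matches the fibre sums of `mixedNorm_update_le` with the sums over outside coordinates in
-- `IsMultipleSummingIn.sum_rpow_le`.
open Classical in
theorem sum_glue_fiber (hC : ∀ l, ∃ k, l ∈ C k) (hdisj : ∀ j k, j ≠ k → Disjoint (C j) (C k))
    (k : Fin n) (j : {l // l ∈ C k} → Fin N) (f : (Fin m → Fin N) → ℝ) :
    (∑ t : ∀ k, {l // l ∈ C k} → Fin N, if t k = j then f (glue C hC t) else 0) =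
      ∑ i : {l // l ∉ C k} → Fin N, f (fun l => if h : l ∈ C k then j ⟨l, h⟩ else i ⟨l, h⟩) := by
  have h1 : (∑ t : ∀ k, {l // l ∈ C k} → Fin N, if t k = j then f (glue C hC t) else 0) =
      ∑ i : Fin m → Fin N, if (fun l : {l // l ∈ C k} => i l) = j then f i else 0 := by
    refine Fintype.sum_equiv (glueEquiv hC hdisj) _ _ fun t => ?_
    have : (fun l : {l // l ∈ C k} => glueEquiv hC hdisj t l) = t k :=
      funext fun l => glue_apply hC hdisj t l.2
    rw [this]
    rfl
  rw [h1, Fintype.sum_equiv (Equiv.piEquivPiSubtypeProd (fun l => l ∈ C k) fun _ => Fin N) _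
    (fun u : ({l // l ∈ C k} → Fin N) × ({l // l ∉ C k} → Fin N) => if u.1 = j then
      f (fun l => if h : l ∈ C k then u.1 ⟨l, h⟩ else u.2 ⟨l, h⟩) else 0) fun i => by
        simp [Equiv.piEquivPiSubtypeProd],
    Fintype.sum_prod_type, Finset.sum_eq_single j (fun b _ hb => by simp [hb]) (by simp)]
  simp

end Glue

end MultSumm

/-! ### Interpolation between the endpoint estimates. -/

theorem mainTheorem3 {𝕜 : Type*} [RCLike 𝕜] {m n : ℕ}
    {X : Fin m → Type*} [∀ l, NormedAddCommGroup (X l)] [∀ l, NormedSpace 𝕜 (X l)]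
    [∀ l, CompleteSpace (X l)]
    {Y : Type*} [NormedAddCommGroup Y] [NormedSpace 𝕜 Y] [CompleteSpace Y]
    (q : ℝ) (hY : MultSumm.HasCotype Y q)
    (r : Fin n → ℝ) (hr : ∀ k, r k ∈ Set.Icc 1 q)
    (C : Fin n → Finset (Fin m)) (hC_nonempty : ∀ k, (C k).Nonempty)
    (hC_proper : ∀ k, C k ≠ Finset.univ)
    (hC_disjoint : ∀ j k, j ≠ k → Disjoint (C j) (C k))
    (hC_cover : ∀ l, ∃ k, l ∈ C k)
    (U : ContinuousMultilinearMap 𝕜 X Y)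
    (hU : ∀ k, MultSumm.IsMultipleSummingIn (r k) U (C k))
    (θ : Fin n → ℝ) (hθ : ∀ k, θ k ∈ Set.Icc (0 : ℝ) 1) (hθ_sum : ∑ k, θ k = 1)
    (s : Fin n → ℝ) (hs_mem : ∀ k, s k ∈ Set.Icc (r k) q)
    (hs : ∀ k, 1 / s k = θ k / r k + (1 - θ k) / q)
    (N : ℕ) (x : ∀ l, Fin N → X l) (hx : ∀ l, MultSumm.weakL1Norm 𝕜 (x l) ≤ 1) :
    MultSumm.mixedNorm n (fun k => {l // l ∈ C k} → Fin N) s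
        (fun t => ‖U (fun l => x l (MultSumm.glue C hC_cover t l))‖) ≤
      ∏ k, (MultSumm.constA 𝕜 Y q (r k) ^ (C k)ᶜ.card *
        MultSumm.blockNorm (r k) U (C k)) ^ θ k := by
  classical
  have hr0 : ∀ k, 0 < r k := fun k => zero_lt_one.trans_le (hr k).1
  have hq0 : 0 < q := two_pos.trans_le hY.1
  set a : (∀ k, {l // l ∈ C k} → Fin N) → ℝ :=
    fun t => ‖U (fun l => x l (MultSumm.glue C hC_cover t l))‖ with ha
  have ha0 : ∀ t, 0 ≤ a t := fun t => norm_nonneg _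
  -- Hölder is applied to `n` copies of the same array.
  have hprod : a = fun t => ∏ k, a t ^ θ k := by
    funext t
    rw [← Real.rpow_sum_of_nonneg (ha0 t) fun k _ => (hθ k).1, hθ_sum, Real.rpow_one]
  -- Here `1 - θ j` is the total weight of the other endpoints, all of which have exponent `q` in
  -- slot `j`.
  have hexp : ∀ j, 1 / s j = ∑ k, θ k / (if j = k then r k else q) := by
    intro j
    rw [hs, ← hθ_sum, ← Finset.add_sum_erase _ θ (Finset.mem_univ j),
      ← Finset.add_sum_erase _ (fun k => θ k / (if j = k then r k else q)) (Finset.mem_univ j),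
      if_pos rfl, add_sub_cancel_left, Finset.sum_div]
    congr 1
    exact Finset.sum_congr rfl fun k hk => by rw [if_neg (Finset.ne_of_mem_erase hk).symm]
  have hblock : ∀ k, MultSumm.mixedNorm n (fun k => {l // l ∈ C k} → Fin N)
      (fun i => if i = k then r k else q) a ≤
      MultSumm.constA 𝕜 Y q (r k) ^ (C k)ᶜ.card * MultSumm.blockNorm (r k) U (C k) := by
    intro k
    refine (MultSumm.mixedNorm_update_le (hr0 k) (hr k).2 n _ k a).trans
      (le_of_eq_of_le ?_ ((hU k).sum_rpow_le hY (hr k).1 (hr k).2 x hx))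
    congr 1
    refine Finset.sum_congr rfl fun j _ => ?_
    congr 1
    rw [← MultSumm.sum_glue_fiber hC_cover hC_disjoint k j
      (fun i => ‖U (fun l => x l (i l))‖ ^ q)]
    simp only [ha, abs_norm]
  calc MultSumm.mixedNorm n (fun k => {l // l ∈ C k} → Fin N) s a
      = MultSumm.mixedNorm n (fun k => {l // l ∈ C k} → Fin N) s (fun t => ∏ k, a t ^ θ k) := by
        rw [← hprod]
    _ ≤ ∏ k, MultSumm.mixedNorm n (fun k => {l // l ∈ C k} → Fin N)
          (fun i => if i = k then r k else q) a ^ θ k :=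
        MultSumm.mixedNorm_prod_rpow_le θ (fun k => (hθ k).1) n _ s
          (fun k i => if i = k then r k else q) (fun j => (hr0 j).trans_le (hs_mem j).1)
          (fun k j => by split_ifs; exacts [hr0 k, hq0]) hexp (fun _ => a)
          (fun _ => ha0)
    _ ≤ _ := Finset.prod_le_prod
        (fun k _ => Real.rpow_nonneg (MultSumm.mixedNorm_nonneg _ _ _ _) _)
        fun k _ => Real.rpow_le_rpow (MultSumm.mixedNorm_nonneg _ _ _ _) (hblock k) (hθ k).1
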